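/- Let $d\ge 3$. Consider a structure with a set $B$ of bodies, subsets $\mathrm{IOb},\mathrm{Ph}\subseteq B$ (inertial observers and light signals), a set $Q$ of quantities with operations $+,\cdot$ and a relation $\le$, and a worldview relation $W\subseteq B\times B\times Q^d$, where $W(m,b,\bar x)$ reads "$m$ coordinatizes $b$ at $\bar x=\langle x_1,\dots,x_d\rangle$". Write $\mathrm{ev}_m(\bar x)=\{b: W(m,b,\bar x)\}$, $\mathrm{time}(\bar x,\bar y)=x_1-y_1$ and $\mathrm{space}^2(\bar x,\bar y)=\sum_{i=2}^d (x_i-y_i)^2$. Assume: - AxOField: $\langle Q,+,\cdot,\le\rangle$ is an ordered field; - AxEv: for all $m,k\in\mathrm{IOb}$ and all $\bar x\in Q^d$ there is $\bar y\in Q^d$ with $\mathrm{ev}_m(\bar x)=\mathrm{ev}_k(\bar y)$; - AxPh: for every $m\in\mathrm{IOb}$ there is $c>0$ in $Q$ such that for all $\bar x,\bar y\in Q^d$: some $p\in\mathrm{Ph}$ satisfies $W(m,p,\bar x)$ and $W(m,p,\bar y)$ if and only if $\mathrm{space}^2(\bar x,\bar y)=c^2\,\mathrm{time}(\bar x,\bar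 y)^2$. For $m\in\mathrm{IOb}$ let $\mathsf c_m$ be the speed of light according to $m$, that is, the (by AxPh unique) $v>0$ in $Q$ such that $\mathrm{space}^2(\bar x,\bar y)=v^2\,\mathrm{time}(\bar x,\bar y)^2$ whenever some $p\in\mathrm{Ph}$ satisfies $W(m,p,\bar x)$ and $W(m,p,\bar y)$. For $m,k\in\mathrm{IOb}$ let the worldview transformation $\mathsf w_{mk}$ be the binary relation on $Q^d$ given by $\mathsf w_{mk}(\bar x,\bar y)\iff \mathrm{ev}_m(\bar x)=\mathrm{ev}_k(\bar y)\neq\emptyset$. For $c>0$ let $S_c(\bar x)=\langle x_1,cx_2,\dots,cx_d\rangle$ and $T_c(\bar x)=\langle cx_1,x_2,\dots,x_d\rangle$. For an automorphism $\alpha$ of the field $\langle Q,+,\cdot\rangle$ (not necessarily order preserving) let $\tilde\alpha(\bar x)=\langle\alpha(x_1),\dots,\alpha(x_d)\rangle$. An almost Lorentz transformation is a linear bijection $A$ of $Q^d$ for which there is $\lambda\ne 0$ in $Q$ with $\mu(A(\bar x))=\lambda\,\mu(\bar x)$ for all $\bar x\in Q^d$, where $\mu(\bar x)=x_1^2-x_2^2-\dots-x_d^2$.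 Functions are regarded as binary relations, and $R\mathbin{;}S=\{\langle a,c\rangle:\exists b\ (R(a,b)\wedge S(b,c))\}$ (so the leftmost map is applied first). Then for all $m,k\in\mathrm{IOb}$: - there are an almost Lorentz transformation $A$, a field automorphism $\alpha$ of $Q$ and a translation $T$ of $Q^d$ with $$\mathsf w_{mk}=S_{\mathsf c_m}^{-1}\mathbin{;}A\mathbin{;}\tilde\alpha\mathbin{;}T\mathbin{;}S_{\mathsf c_k};$$ - there are an almost Lorentz transformation $A$, a field automorphism $\alpha$ of $Q$ and a translation $T$ of $Q^d$ with $$\mathsf w_{mk}=T_{\mathsf c_m}\mathbin{;}A\mathbin{;}\tilde\alpha\mathbin{;}T\mathbin{;}T_{\mathsf c_k}^{-1}.$$ -/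

import Mathlib

open scoped SetRel

/-- Models of the two-sorted language of `d`-dimensional spacetimes: `B` is the sort of bodies,
`Q` the sort of quantities, and `W m b x` says that `m` coordinatizes `b` at the coordinate
point `x`. The coordinate with index `0` is time, the remaining ones are spatial. -/
structure SpacetimeModel (d : ℕ) (B Q : Type*) where
  /-- the observers -/
  Ob : Set B
  /-- the inertial observers -/
  IOb : Set B
  /-- the light signals -/
  Ph : Set B
  /-- the worldview relation -/
  W : B → B → (Fin d → Q) → Prop

namespace SpacetimeModel

section Coordinates

variable {d : ℕ} [NeZero d] {Q : Type*} [Field Q]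

/-- Time difference of two coordinate points. -/
def time (x y : Fin d → Q) : Q := x 0 - y 0

/-- Squared spatial distance of two coordinate points. -/
def space2 (x y : Fin d → Q) : Q := ∑ i ∈ Finset.univ.erase (0 : Fin d), (x i - y i) ^ 2

/-- The `c`-Minkowski quadratic form `c x₁² - x₂² - ⋯ - x_d²`. -/
def minkowski (c : Q) (x : Fin d → Q) : Q :=
  c * x 0 ^ 2 - ∑ i ∈ Finset.univ.erase (0 : Fin d), x i ^ 2

/-- Almost Lorentz transformations: linear bijections multiplying the `1`-Minkowski form by a
nonzero constant. -/
def IsAlmostLorentz (A : (Fin d → Q) ≃ₗ[Q] (Fin d → Q)) : Prop :=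
  ∃ l : Q, l ≠ 0 ∧ ∀ x, minkowski 1 (A x) = l * minkowski 1 x

/-- Rescaling of the spatial coordinates, `⟨x₁, c x₂, …, c x_d⟩`. -/
def spaceRescale (c : Q) (x : Fin d → Q) : Fin d → Q := fun i => if i = 0 then x i else c * x i

/-- Rescaling of the time coordinate, `⟨c x₁, x₂, …, x_d⟩`. -/
def timeRescale (c : Q) (x : Fin d → Q) : Fin d → Q := fun i => if i = 0 then c * x i else x i

end Coordinates

/-- The map induced by a field automorphism, acting on each coordinate (the automorphism need not
preserve the order). -/
def autInduced {d : ℕ} {Q : Type*} [Field Q] (α : Q ≃+* Q) (x : Fin d → Q) : Fin d → Q :=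
  fun i => α (x i)

/-- Translation by the vector `b`. -/
def translation {d : ℕ} {Q : Type*} [Field Q] (b x : Fin d → Q) : Fin d → Q := x + b

section Model

variable {d : ℕ} {B Q : Type*} (M : SpacetimeModel d B Q)

/-- The event occurring for `m` at `x`: the set of bodies that `m` coordinatizes at `x`. -/
def ev (m : B) (x : Fin d → Q) : Set B := {b | M.W m b x}

/-- The worldview transformation between `m` and `k`: the binary relation connecting the
coordinate points at which `m` and `k` coordinatize the same nonempty event. -/
def worldview (m k : B) : SetRel (Fin d → Q) (Fin d → Q) :=
  {p | M.ev m p.1 = M.ev k p.2 ∧ (M.ev m p.1).Nonempty}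

/-- All inertial observers coordinatize the same set of events. -/
def AxEv : Prop :=
  ∀ m ∈ M.IOb, ∀ k ∈ M.IOb, ∀ x : Fin d → Q, ∃ y : Fin d → Q, M.ev m x = M.ev k y

variable [NeZero d] [Field Q] [LinearOrder Q]

/-- For every inertial observer there is a positive quantity `c` such that two coordinate points
can be connected by a light signal exactly if they lie on a line of speed `c`. -/
def AxPh : Prop :=
  ∀ m ∈ M.IOb, ∃ c : Q, 0 < c ∧ ∀ x y : Fin d → Q,
    (∃ p ∈ M.Ph, M.W m p x ∧ M.W m p y) ↔ space2 x y = c ^ 2 * time x y ^ 2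

/-- `v` is the speed of light according to `m`. -/
def IsLightSpeed (m : B) (v : Q) : Prop :=
  0 < v ∧ ∀ x y : Fin d → Q,
    (∃ p ∈ M.Ph, M.W m p x ∧ M.W m p y) → space2 x y = v ^ 2 * time x y ^ 2

/-- Under the light axiom every inertial observer has exactly one speed of light, so that it may be
denoted by `c_m`. -/
theorem existsUnique_isLightSpeed [IsStrictOrderedRing Q] (hd : 2 ≤ d) (hPh : M.AxPh)
    {m : B} (hm : m ∈ M.IOb) : ∃! v : Q, M.IsLightSpeed m v := by
  obtain ⟨c, hc, h⟩ := hPh m hm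
  refine ⟨c, ⟨hc, fun x y => (h x y).1⟩, ?_⟩
  rintro v ⟨hv, hv2⟩
  have h1 : (⟨1, hd⟩ : Fin d) ∈ Finset.univ.erase (0 : Fin d) := by
    simp [Fin.ext_iff]
  let x : Fin d → Q := fun i => if i = 0 then 1 else if i = ⟨1, hd⟩ then c else 0
  have hs : space2 x 0 = c ^ 2 := by
    unfold space2
    rw [Finset.sum_eq_single_of_mem _ h1]
    · have : (⟨1, hd⟩ : Fin d) ≠ 0 := by simp [Fin.ext_iff]
      simp [x, this]
    · intro i hi hi1
      have : i ≠ 0 := by simpa using hi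
      simp [x, this, hi1]
  have ht : time x 0 = 1 := by simp [time, x]
  have := hv2 x 0 ((h x 0).2 (by rw [hs, ht]; ring))
  rw [hs, ht] at this
  have h3 : c ^ 2 = v ^ 2 := by simpa using this
  exact ((pow_left_inj₀ hc.le hv.le two_ne_zero).1 h3).symm

end Model

end SpacetimeModel

/-!
In coordinates rescaled so that light has speed one, the worldview transformation is a surjection
`g` that preserves, in both directions, the relation of differing by a null vector of the Lorentz
form `B`; normalise it by `g 0 = 0`. Only null differences are needed to express that a vector is
orthogonal to a null vector, so `g` respects null hyperplanes, and hence maps parallel null lines to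
parallel null lines. Completing parallelograms makes `g` additive, because null vectors span. On
each null line `g` now acts through an additive map of scalars. These maps are multiplicative and
agree with each other, since `g` carries one hyperbola `r t = c s ^ 2` cut out of the null cone by
the span of a hyperbolic pair and a vector orthogonal to it to another, so `g` is semilinear.
Finally `B (g x) (g y)` is a constant multiple of the conjugate of `B x y`, as both vanish
together whenever `y` is null.
-/

/-- Nondegenerate symmetric forms of Witt index one: they have nonzero null vectors, but orthogonal
null vectors are proportional. Lorentz forms are the motivating example. -/
structure HasWittIndexOne {K V : Type*} [Field K] [AddCommGroup V] [Module K V]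
    (B : LinearMap.BilinForm K V) : Prop where
  isSymm : B.IsSymm
  separatingLeft : B.SeparatingLeft
  exists_null : ∃ n, n ≠ 0 ∧ B n n = 0
  exists_eq_smul : ∀ ⦃u v⦄, u ≠ 0 → B u u = 0 → B v v = 0 → B u v = 0 → ∃ t : K, v = t • u

/-- Surjections preserving, in both directions, the relation of differing by a null vector. In
the Lorentzian case this is the relation of being connectible by a light signal. -/
structure IsNullAutomorphism {K V : Type*} [Field K] [AddCommGroup V] [Module K V]
    (B : LinearMap.BilinForm K V) (g : V → V) : Prop where
  surjective : Function.Surjective g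
  null_sub_iff : ∀ x y, B (g x - g y) (g x - g y) = 0 ↔ B (x - y) (x - y) = 0

section WittIndexOne

variable {K V : Type*} [Field K] [AddCommGroup V] [Module K V] {B : LinearMap.BilinForm K V}

theorem bilinForm_add_self (hB : B.IsSymm) (x y : V) :
    B (x + y) (x + y) = B x x + 2 * B x y + B y y := by
  simp only [map_add, LinearMap.add_apply, hB.eq y x]
  ring

theorem bilinForm_sub_self (hB : B.IsSymm) (x y : V) :
    B (x - y) (x - y) = B x x - 2 * B x y + B y y := by
  simp only [map_sub, LinearMap.sub_apply, hB.eq y x]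
  ring

theorem bilinForm_smul_self (t : K) (x : V) : B (t • x) (t • x) = t ^ 2 * B x x := by
  simp only [map_smul, LinearMap.smul_apply, smul_eq_mul]
  ring

theorem bilinForm_add_hyperbolic_self (hB : B.IsSymm) {n p w : V} (hn : B n n = 0)
    (hp : B p p = 0) (hnw : B n w = 0) (hpw : B p w = 0) (t r : K) :
    B (w + (t • p + r • n)) (w + (t • p + r • n)) = B w w + 2 * B n p * (r * t) := by
  simp only [map_add, map_smul, LinearMap.add_apply, LinearMap.smul_apply, smul_eq_mul,
    hB.eq w n, hB.eq w p, hB.eq p n, hn, hp, hnw, hpw]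
  ring

namespace HasWittIndexOne

theorem apply_ne_zero_or (hB : HasWittIndexOne B) {n p m : V} (hn : B n n = 0)
    (hnp : B n p ≠ 0) (hm : B m m = 0) (hm0 : m ≠ 0) : B m n ≠ 0 ∨ B m p ≠ 0 := by
  by_contra! h
  obtain ⟨t, rfl⟩ := hB.exists_eq_smul hm0 hm hn h.1
  exact hnp (by simp [h.2])

theorem exists_orthogonal_not_null (hB : HasWittIndexOne B) (hV : 2 < Module.rank K V) {n p : V}
    (hn : B n n = 0) (hnp : B n p ≠ 0) : ∃ w, B n w = 0 ∧ B p w = 0 ∧ B w w ≠ 0 := by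
  have hn0 : n ≠ 0 := by rintro rfl; simp at hnp
  have hnot : ¬ Function.Injective ((B n).prod (B p)) := fun h => by
    have hle := LinearMap.lift_rank_le_of_injective _ h
    rw [rank_prod', CommSemiring.rank_self, one_add_one_eq_two, Cardinal.lift_ofNat,
      Cardinal.lift_le_ofNat_iff] at hle
    exact hV.not_ge hle
  obtain ⟨w, hw, hw0⟩ : ∃ w, (B n).prod (B p) w = 0 ∧ w ≠ 0 := by
    rw [injective_iff_map_eq_zero] at hnot
    push Not at hnot
    exact hnot
  obtain ⟨hnw, hpw⟩ : B n w = 0 ∧ B p w = 0 := by simpa using hw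
  refine ⟨w, hnw, hpw, fun hww => ?_⟩
  obtain ⟨t, rfl⟩ := hB.exists_eq_smul hn0 hn hww hnw
  rw [map_smul, smul_eq_mul, hB.isSymm.eq, mul_eq_zero] at hpw
  exact hw0 (by rw [hpw.resolve_right hnp, zero_smul])

variable [NeZero (2 : K)]

theorem null_sub_smul (hB : HasWittIndexOne B) {n x : V} (hn : B n n = 0) (hnx : B n x ≠ 0) :
    B (x - (B x x / (2 * B n x)) • n) (x - (B x x / (2 * B n x)) • n) = 0 := by
  have two_ne : (2 : K) ≠ 0 := two_ne_zero
  rw [bilinForm_sub_self hB.isSymm, bilinForm_smul_self, map_smul, smul_eq_mul,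
    hB.isSymm.eq x n, hn]
  field_simp
  ring

theorem exists_null_apply_ne_zero (hB : HasWittIndexOne B) {n : V} (hn : B n n = 0)
    (hn0 : n ≠ 0) : ∃ p, B p p = 0 ∧ B n p ≠ 0 := by
  obtain ⟨v, hv⟩ : ∃ v, B n v ≠ 0 := by
    by_contra! h
    exact hn0 (hB.separatingLeft n h)
  exact ⟨_, hB.null_sub_smul hn hv, by simpa [hn] using hv⟩

theorem exists_hyperbolic_pair (hB : HasWittIndexOne B) :
    ∃ n p, B n n = 0 ∧ B p p = 0 ∧ B n p ≠ 0 := by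
  obtain ⟨n, hn0, hn⟩ := hB.exists_null
  obtain ⟨p, hp, hnp⟩ := hB.exists_null_apply_ne_zero hn hn0
  exact ⟨n, p, hn, hp, hnp⟩

theorem eq_of_forall_null_sub_iff (hB : HasWittIndexOne B) {x y : V}
    (h : ∀ z, B (z - x) (z - x) = 0 ↔ B (z - y) (z - y) = 0) : x = y := by
  have hnull : B (x - y) (x - y) = 0 := (h x).1 (by simp)
  by_contra hne
  obtain ⟨p, hp, hxp⟩ := hB.exists_null_apply_ne_zero hnull (sub_ne_zero.2 hne)
  have hxyp : B (x - y + p) (x - y + p) = 0 := by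
    rw [← add_sub_right_comm, ← h, add_sub_cancel_left, hp]
  rw [bilinForm_add_self hB.isSymm, hnull, hp] at hxyp
  exact hxp (by simpa [two_ne_zero] using hxyp)

/-- The right-hand side only mentions null differences, so that null automorphisms preserve
orthogonality to null vectors. -/
theorem apply_eq_zero_iff_null_sub (hB : HasWittIndexOne B) {n : V} (hn : B n n = 0)
    (hn0 : n ≠ 0) (x : V) : B x n = 0 ↔ (B x x = 0 ∧ B (x - n) (x - n) = 0) ∨
      ∀ z, B z z = 0 → B (z - n) (z - n) = 0 → B (z - x) (z - x) ≠ 0 := by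
  have two_ne : (2 : K) ≠ 0 := two_ne_zero
  have hsub : ∀ z, B (z - n) (z - n) = B z z - 2 * B z n := fun z => by
    rw [bilinForm_sub_self hB.isSymm, hn, add_zero]
  have hline : ∀ t : K, B (t • n - x) (t • n - x) = B x x - 2 * t * B x n := fun t => by
    rw [bilinForm_sub_self hB.isSymm, bilinForm_smul_self, hn, map_smul, LinearMap.smul_apply,
      hB.isSymm.eq n, smul_eq_mul]
    ring
  constructor
  · intro hxn
    by_cases hx : B x x = 0
    · exact Or.inl ⟨hx, by rw [hsub, hx, hxn]; simp⟩
    · refine Or.inr fun z hz hzn hzx => hx ?_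
      have hnz : B n z = 0 := by
        rw [hsub, hz, hB.isSymm.eq z n] at hzn
        simpa [two_ne] using hzn
      obtain ⟨t, rfl⟩ := hB.exists_eq_smul hn0 hn hz hnz
      rw [hline, hxn] at hzx
      simpa using hzx
  · rintro (⟨hx, hxn⟩ | h)
    · rw [hsub, hx] at hxn
      simpa [two_ne] using hxn
    · by_contra hxn
      refine h ((B x x / (2 * B x n)) • n) (by simp [hn]) (by simp [hn]) ?_
      rw [hline]
      field_simp
      ring

theorem span_null_apply_ne_zero (hB : HasWittIndexOne B) (hV : 2 < Module.rank K V) {n : V}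
    (hn : B n n = 0) (hn0 : n ≠ 0) : Submodule.span K {p | B p p = 0 ∧ B n p ≠ 0} = ⊤ := by
  set S := Submodule.span K {p | B p p = 0 ∧ B n p ≠ 0}
  have two_ne : (2 : K) ≠ 0 := two_ne_zero
  obtain ⟨p, hpn, hnp⟩ := hB.exists_null_apply_ne_zero hn hn0
  obtain ⟨w, hnw, hpw, hw⟩ := hB.exists_orthogonal_not_null hV hn hnp
  have mem_of_apply_ne : ∀ x, B n x ≠ 0 → x - (B x x / (2 * B n x)) • n ∈ S := fun x hx =>
    Submodule.subset_span ⟨hB.null_sub_smul hn hx, by simpa [hn] using hx⟩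
  have hnS : n ∈ S := by
    have hpS : p ∈ S := Submodule.subset_span ⟨hpn, hnp⟩
    have hpw_self : ∀ e : K, e ^ 2 = 1 → B (p + e • w) (p + e • w) = B w w := fun e he => by
      rw [bilinForm_add_self hB.isSymm, bilinForm_smul_self, map_smul, hpn, hpw, he]
      simp
    have hpwS : ∀ e : K, e ^ 2 = 1 → p + e • w - (B w w / (2 * B n p)) • n ∈ S := fun e he => by
      have hnpw : B n (p + e • w) = B n p := by simp [hnw]
      simpa only [hnpw, hpw_self e he] using mem_of_apply_ne (p + e • w) (hnpw ▸ hnp)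
    have hc : 2 * (B w w / (2 * B n p)) ≠ 0 := by positivity
    refine (S.smul_mem_iff hc).1 ?_
    convert S.sub_mem (S.smul_mem (2 : K) hpS)
      (S.add_mem (hpwS 1 (by simp)) (hpwS (-1) (by simp))) using 1
    module
  have hS : ∀ x, B n x ≠ 0 → x ∈ S := fun x hx => by
    simpa using S.add_mem (mem_of_apply_ne x hx) (S.smul_mem (B x x / (2 * B n x)) hnS)
  refine eq_top_iff.2 fun x _ => ?_
  by_cases hx : B n x = 0
  · simpa using S.sub_mem (hS (x + p) (by simpa [hx] using hnp)) (hS p hnp)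
  · exact hS x hx

theorem span_null (hB : HasWittIndexOne B) (hV : 2 < Module.rank K V) :
    Submodule.span K {n | B n n = 0} = ⊤ := by
  obtain ⟨n, hn0, hn⟩ := hB.exists_null
  exact top_unique <| (hB.span_null_apply_ne_zero hV hn hn0).ge.trans <|
    Submodule.span_mono fun _ hp => hp.1

end HasWittIndexOne

theorem addMonoidHom_ext_mul_sq [NeZero (2 : K)] {A : Type*} [AddGroup A] {f₁ f₂ : K →+ A}
    {c : K} (hc : c ≠ 0) (h : ∀ s, f₁ (c * s ^ 2) = f₂ (c * s ^ 2)) : f₁ = f₂ := by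
  ext u
  -- Every scalar is a difference of two squares.
  have hu : u = c * ((u / c + 1) / 2) ^ 2 - c * ((u / c - 1) / 2) ^ 2 := by
    have := two_ne_zero (α := K)
    field_simp
    ring
  rw [hu, map_sub, map_sub, h, h]

namespace IsNullAutomorphism

section Map

variable {g : V → V}

theorem recenter (hg : IsNullAutomorphism B g) (a : V) :
    IsNullAutomorphism B fun x => g (a + x) - g a where
  surjective := (Equiv.subRight (g a)).surjective.comp
    (hg.surjective.comp (Equiv.addLeft a).surjective)
  null_sub_iff x y := by rw [sub_sub_sub_cancel_right, hg.null_sub_iff, add_sub_add_left_eq_sub]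

theorem null_iff (hg : IsNullAutomorphism B g) (h0 : g 0 = 0) (x : V) :
    B (g x) (g x) = 0 ↔ B x x = 0 := by
  simpa [h0] using hg.null_sub_iff x 0

variable [NeZero (2 : K)]

theorem injective (hB : HasWittIndexOne B) (hg : IsNullAutomorphism B g) :
    Function.Injective g := fun x y hxy =>
  hB.eq_of_forall_null_sub_iff fun z => by rw [← hg.null_sub_iff, hxy, hg.null_sub_iff]

protected theorem map_ne_zero (hB : HasWittIndexOne B) (hg : IsNullAutomorphism B g)
    (h0 : g 0 = 0) {x : V} (hx : x ≠ 0) : g x ≠ 0 :=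
  h0 ▸ (hg.injective hB).ne hx

theorem apply_map_eq_zero_iff (hB : HasWittIndexOne B) (hg : IsNullAutomorphism B g)
    (h0 : g 0 = 0) {n : V} (hn : B n n = 0) (x : V) : B (g x) (g n) = 0 ↔ B x n = 0 := by
  obtain rfl | hn0 := eq_or_ne n 0
  · simp [h0]
  · rw [hB.apply_eq_zero_iff_null_sub ((hg.null_iff h0 n).2 hn) (hg.map_ne_zero hB h0 hn0),
      hB.apply_eq_zero_iff_null_sub hn hn0, hg.surjective.forall]
    simp only [ne_eq, hg.null_sub_iff, hg.null_iff h0]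

theorem exists_map_smul (hB : HasWittIndexOne B) (hg : IsNullAutomorphism B g) (h0 : g 0 = 0)
    {n : V} (hn : B n n = 0) (t : K) : ∃ s : K, g (t • n) = s • g n := by
  obtain rfl | hn0 := eq_or_ne n 0
  · simp [h0]
  exact hB.exists_eq_smul (hg.map_ne_zero hB h0 hn0) ((hg.null_iff h0 n).2 hn)
    ((hg.null_iff h0 _).2 (by simp [hn]))
    (by rw [hB.isSymm.eq, hg.apply_map_eq_zero_iff hB h0 hn]; simp [hn])

/-- Parallel null lines have parallel images: the hyperplanes tangent to the images along two null
lines would otherwise meet, whereas those along the original lines coincide or are disjoint. -/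
theorem exists_map_add_sub_eq_smul (hB : HasWittIndexOne B) (hg : IsNullAutomorphism B g)
    (h0 : g 0 = 0) {n : V} (hn : B n n = 0) (b : V) :
    ∃ s : K, g (b + n) - g b = s • g n := by
  obtain rfl | hn0 := eq_or_ne n 0
  · exact ⟨0, by simp⟩
  have hgn : B (g n) (g n) = 0 := (hg.null_iff h0 n).2 hn
  have hv : B (g (b + n) - g b) (g (b + n) - g b) = 0 := by
    rw [hg.null_sub_iff, add_sub_cancel_left, hn]
  refine hB.exists_eq_smul (hg.map_ne_zero hB h0 hn0) hgn hv ?_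
  rw [hB.isSymm.eq]
  by_cases hbn : B b n = 0
  · rw [map_sub, LinearMap.sub_apply, (hg.apply_map_eq_zero_iff hB h0 hn _).2 hbn,
      (hg.apply_map_eq_zero_iff hB h0 hn _).2 (by simp [hbn, hn]), sub_zero]
  · by_contra hne
    rw [hB.isSymm.eq] at hne
    obtain ⟨x, hx⟩ := hg.surjective
      ((B (g b) (g (b + n) - g b) / B (g n) (g (b + n) - g b)) • g n)
    have hxn : B x n = 0 := by
      rw [← hg.apply_map_eq_zero_iff hB h0 hn, hx]
      simp [hgn]
    have hxbn : B (x - b) n = 0 := by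
      rw [← (hg.recenter b).apply_map_eq_zero_iff hB (by simp) hn, add_sub_cancel, hx,
        map_sub B, LinearMap.sub_apply, map_smul, LinearMap.smul_apply, smul_eq_mul,
        div_mul_cancel₀ _ hne, sub_self]
    exact hbn (by simpa [hxn] using hxbn)

theorem map_add_of_null_of_null (hB : HasWittIndexOne B) (hg : IsNullAutomorphism B g)
    (h0 : g 0 = 0) {n p : V} (hn : B n n = 0) (hp : B p p = 0) (hnp : B n p ≠ 0) :
    g (p + n) = g p + g n := by
  obtain ⟨s, hs⟩ := hg.exists_map_add_sub_eq_smul hB h0 hn p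
  obtain ⟨t, ht⟩ := hg.exists_map_add_sub_eq_smul hB h0 hp n
  have hsides : (s - 1) • g n = (t - 1) • g p := by
    rw [sub_smul, sub_smul, ← hs, ← ht, add_comm n p]
    module
  have hpair : (s - 1) * B (g n) (g p) = 0 := by
    simpa [(hg.null_iff h0 p).2 hp] using congrArg (B · (g p)) hsides
  have hgnp : B (g n) (g p) ≠ 0 := (hg.apply_map_eq_zero_iff hB h0 hp n).not.2 hnp
  rw [← sub_eq_iff_eq_add', hs, sub_eq_zero.1 ((mul_eq_zero.1 hpair).resolve_right hgnp), one_smul]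

theorem map_add_null (hB : HasWittIndexOne B) (hV : 2 < Module.rank K V)
    (hg : IsNullAutomorphism B g) (h0 : g 0 = 0) {n : V} (hn : B n n = 0) (w : V) :
    g (w + n) = g w + g n := by
  obtain rfl | hn0 := eq_or_ne n 0
  · simp [h0]
  have hw : w ∈ Submodule.span K {p | B p p = 0 ∧ B n p ≠ 0} :=
    hB.span_null_apply_ne_zero hV hn hn0 ▸ Submodule.mem_top
  have translate : ∀ a, g (a + w + n) - g (a + w) = g (a + n) - g a := by
    induction hw using Submodule.closure_induction with
    | zero => simp
    | add v w _ _ hv hw => intro a; rw [← add_assoc, hw, hv]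
    | smul_mem r p hp =>
      intro a
      obtain rfl | hr := eq_or_ne r 0
      · simp
      have h := (hg.recenter a).map_add_of_null_of_null hB (by simp) hn (p := r • p)
        (by simp [hp.1]) (by simp [hr, hp.2])
      rw [add_assoc, sub_eq_iff_eq_add.1 h]
      abel
  simpa [h0, sub_eq_iff_eq_add'] using translate 0

protected theorem map_add (hB : HasWittIndexOne B) (hV : 2 < Module.rank K V)
    (hg : IsNullAutomorphism B g) (h0 : g 0 = 0) (v w : V) : g (v + w) = g v + g w := by
  have hw : w ∈ Submodule.span K {n | B n n = 0} := hB.span_null hV ▸ Submodule.mem_top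
  induction hw using Submodule.closure_induction generalizing v with
  | zero => simp [h0]
  | add w₁ w₂ _ _ h₁ h₂ => rw [← add_assoc, h₂, h₁, h₂, add_assoc]
  | smul_mem r n hn => exact hg.map_add_null hB hV h0 (by simp [show B n n = 0 from hn]) v

end Map

section Additive

variable {g : V →+ V} [NeZero (2 : K)]

theorem exists_multiplier (hB : HasWittIndexOne B) (hg : IsNullAutomorphism B g) {n : V}
    (hn : B n n = 0) :
    ∃ f : K →+ K, f 1 = 1 ∧ ∀ t, g (t • n) = f t • g n := by
  obtain rfl | hn0 := eq_or_ne n 0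
  · exact ⟨AddMonoidHom.id K, by simp⟩
  have hgn := hg.map_ne_zero hB (map_zero g) hn0
  choose f hf using hg.exists_map_smul hB (map_zero g) hn
  refine ⟨AddMonoidHom.mk' f fun s t => smul_left_injective K hgn ?_,
    smul_left_injective K hgn ?_, hf⟩
  · simp only [add_smul, ← hf, map_add]
  · simp only [AddMonoidHom.mk'_apply]
    rw [← hf, one_smul, one_smul]

/-- For `w` orthogonal to `n` and `p`, nullity of `s • w + (t • p + r • n)` only depends on `s` and
`r * t`, and the same holds after applying `g`. -/
theorem exists_multiplier_mul_of_eq_mul_sq (hB : HasWittIndexOne B) (hV : 2 < Module.rank K V)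
    (hg : IsNullAutomorphism B g) {n p : V} (hn : B n n = 0) (hp : B p p = 0) (hnp : B n p ≠ 0)
    {fn fp : K →+ K} (hfn : ∀ t, g (t • n) = fn t • g n) (hfp : ∀ t, g (t • p) = fp t • g p)
    (hfp1 : fp 1 = 1) :
    ∃ c : K, c ≠ 0 ∧ ∀ s r t : K, r * t = c * s ^ 2 → fn (r * t) = fn r * fp t := by
  have two_ne : (2 : K) ≠ 0 := two_ne_zero
  have hg0 : g 0 = 0 := map_zero g
  have hgn := (hg.null_iff hg0 n).2 hn
  have hgp := (hg.null_iff hg0 p).2 hp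
  have hgnp : B (g n) (g p) ≠ 0 := (hg.apply_map_eq_zero_iff hB hg0 hp n).not.2 hnp
  obtain ⟨w, hnw, hpw, hw⟩ := hB.exists_orthogonal_not_null hV hn hnp
  have map_orthogonal : ∀ {q} (s : K), B q q = 0 → B q w = 0 → B (g q) (g (s • w)) = 0 :=
    fun s hq hqw => by
      rw [hB.isSymm.eq, hg.apply_map_eq_zero_iff hB hg0 hq, hB.isSymm.eq]
      simp [hqw]
  have hcone : ∀ s r t : K, r * t = -B w w / (2 * B n p) * s ^ 2 →
      B (g (s • w)) (g (s • w)) + 2 * B (g n) (g p) * (fn r * fp t) = 0 := by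
    intro s r t hst
    rw [← bilinForm_add_hyperbolic_self hB.isSymm hgn hgp (map_orthogonal s hn hnw)
      (map_orthogonal s hp hpw), ← hfn, ← hfp, ← map_add, ← map_add, hg.null_iff hg0,
      bilinForm_add_hyperbolic_self hB.isSymm hn hp (by simp [hnw]) (by simp [hpw]), hst,
      bilinForm_smul_self]
    field_simp
    ring
  refine ⟨_, div_ne_zero (neg_ne_zero.2 hw) (mul_ne_zero two_ne hnp), fun s r t hst => ?_⟩
  have h := (hcone s (r * t) 1 (by rw [mul_one, hst])).trans (hcone s r t hst).symm
  rw [hfp1, mul_one] at h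
  exact mul_left_cancel₀ (mul_ne_zero two_ne hgnp) (add_left_cancel h)

theorem multiplier_mul (hB : HasWittIndexOne B) (hV : 2 < Module.rank K V)
    (hg : IsNullAutomorphism B g) {n p : V} (hn : B n n = 0) (hp : B p p = 0) (hnp : B n p ≠ 0)
    {fn fp : K →+ K} (hfn : ∀ t, g (t • n) = fn t • g n) (hfp : ∀ t, g (t • p) = fp t • g p)
    (hfp1 : fp 1 = 1) (r t : K) : fn (r * t) = fn r * fp t := by
  obtain ⟨c, hc, hmul⟩ :=
    hg.exists_multiplier_mul_of_eq_mul_sq hB hV hn hp hnp hfn hfp hfp1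
  obtain rfl | ht := eq_or_ne t 0
  · simp
  have hext : fn.comp (AddMonoidHom.mulRight t) = (AddMonoidHom.mulRight (fp t)).comp fn :=
    addMonoidHom_ext_mul_sq (mul_ne_zero hc ht) fun s => hmul (t * s) (c * t * s ^ 2) t (by ring)
  exact DFunLike.congr_fun hext r

theorem multiplier_eq (hB : HasWittIndexOne B) (hV : 2 < Module.rank K V)
    (hg : IsNullAutomorphism B g) {n p : V} (hn : B n n = 0) (hp : B p p = 0) (hnp : B n p ≠ 0)
    {fn fp : K →+ K} (hfn : ∀ t, g (t • n) = fn t • g n) (hfp : ∀ t, g (t • p) = fp t • g p)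
    (hfn1 : fn 1 = 1) (hfp1 : fp 1 = 1) : fn = fp := by
  ext t
  simpa [hfn1] using hg.multiplier_mul hB hV hn hp hnp hfn hfp hfp1 1 t

theorem exists_map_smul_eq (hB : HasWittIndexOne B) (hV : 2 < Module.rank K V)
    (hg : IsNullAutomorphism B g) :
    ∃ f : K →+* K, ∀ (t : K) (x : V), g (t • x) = f t • g x := by
  obtain ⟨n, p, hn, hp, hnp⟩ := hB.exists_hyperbolic_pair
  obtain ⟨fn, hfn1, hfn⟩ := hg.exists_multiplier hB hn
  obtain ⟨fp, hfp1, hfp⟩ := hg.exists_multiplier hB hp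
  obtain rfl : fn = fp := hg.multiplier_eq hB hV hn hp hnp hfn hfp hfn1 hfp1
  refine ⟨{ fn with
    map_one' := hfn1
    map_mul' := hg.multiplier_mul hB hV hn hp hnp hfn hfp hfn1 }, fun t x => ?_⟩
  change g (t • x) = fn t • g x
  have hx : x ∈ Submodule.span K {m | B m m = 0} := hB.span_null hV ▸ Submodule.mem_top
  induction hx using Submodule.closure_induction with
  | zero => simp
  | add x y _ _ hx hy => rw [smul_add, map_add, hx, hy, map_add, smul_add]
  | smul_mem r m hm =>
    obtain rfl | hm0 := eq_or_ne m 0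
    · simp
    obtain ⟨fm, hfm1, hfm⟩ := hg.exists_multiplier hB hm
    obtain rfl : fm = fn := (hB.apply_ne_zero_or hn hnp hm hm0).elim
      (fun h => hg.multiplier_eq hB hV hm hn h hfm hfn hfm1 hfn1)
      (fun h => hg.multiplier_eq hB hV hm hp h hfm hfp hfm1 hfp1)
    rw [smul_smul, hfm, hfm, smul_smul, hg.multiplier_mul hB hV hn hp hnp hfn hfp hfn1]

theorem surjective_of_map_smul_eq (hB : HasWittIndexOne B) (hg : IsNullAutomorphism B g)
    {f : K →+* K} (hf : ∀ (t : K) (x : V), g (t • x) = f t • g x) : Function.Surjective f := by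
  intro s
  have hg0 : g 0 = 0 := map_zero g
  obtain ⟨n, hn0, hn⟩ := hB.exists_null
  have hgn : B (g n) (g n) = 0 := (hg.null_iff hg0 n).2 hn
  obtain ⟨x, hx⟩ := hg.surjective (s • g n)
  have hxx : B x x = 0 := (hg.null_iff hg0 x).1 (by simp [hx, hgn])
  have hnx : B n x = 0 := by
    rw [hB.isSymm.eq, ← hg.apply_map_eq_zero_iff hB hg0 hn, hx]
    simp [hgn]
  obtain ⟨t, rfl⟩ := hB.exists_eq_smul hn0 hn hxx hnx
  exact ⟨t, smul_left_injective K (hg.map_ne_zero hB hg0 hn0) (by simpa [hf] using hx)⟩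

end Additive

section Semilinear

variable {σ : K ≃+* K} {L : V →ₛₗ[(σ : K →+* K)] V} [NeZero (2 : K)]

theorem exists_apply_map_eq (hB : HasWittIndexOne B) (hL : IsNullAutomorphism B L) {m : V}
    (hm : B m m = 0) :
    ∃ l : K, ∀ x, B (L x) (L m) = l * σ (B x m) := by
  obtain rfl | hm0 := eq_or_ne m 0
  · simp
  obtain ⟨p, -, hmp⟩ := hB.exists_null_apply_ne_zero hm hm0
  rw [hB.isSymm.eq] at hmp
  refine ⟨B (L p) (L m) / σ (B p m), fun x => ?_⟩
  have hx : B (L (x - (B x m / B p m) • p)) (L m) = 0 := by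
    rw [hL.apply_map_eq_zero_iff hB (map_zero L) hm]
    simp [hmp]
  rw [map_sub, map_smulₛₗ, map_sub B, LinearMap.sub_apply, map_smul, LinearMap.smul_apply,
    sub_eq_zero] at hx
  rw [hx, RingEquiv.coe_toRingHom, map_div₀, smul_eq_mul, div_mul_eq_mul_div, mul_comm,
    div_mul_eq_mul_div]

theorem exists_ne_zero_apply_map_eq (hB : HasWittIndexOne B) (hV : 2 < Module.rank K V)
    (hL : IsNullAutomorphism B L) :
    ∃ l : K, l ≠ 0 ∧ ∀ x y, B (L x) (L y) = l * σ (B x y) := by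
  obtain ⟨n, p, hn, hp, hnp⟩ := hB.exists_hyperbolic_pair
  obtain ⟨l, hl⟩ := hL.exists_apply_map_eq hB hn
  obtain ⟨lp, hlp⟩ := hL.exists_apply_map_eq hB hp
  have eq_of_apply_ne : ∀ {q m : V} {lq lm : K}, B m q ≠ 0 →
      (∀ x, B (L x) (L q) = lq * σ (B x q)) → (∀ x, B (L x) (L m) = lm * σ (B x m)) →
      lm = lq := fun {q m lq lm} hmq hq hm => by
    refine mul_right_cancel₀ ((map_ne_zero σ).2 hmq) ?_
    rw [← hq, hB.isSymm.eq m q, ← hm, hB.isSymm.eq]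
  obtain rfl : l = lp := eq_of_apply_ne hnp hlp hl
  have hl0 : l ≠ 0 := by
    rintro rfl
    exact hnp (by rw [← hL.apply_map_eq_zero_iff hB (map_zero L) hp, hlp, zero_mul])
  refine ⟨l, hl0, fun x y => ?_⟩
  have hy : y ∈ Submodule.span K {m | B m m = 0} := hB.span_null hV ▸ Submodule.mem_top
  induction hy using Submodule.span_induction with
  | zero => simp
  | add y z _ _ hy hz => simp only [map_add, hy, hz, mul_add]
  | smul r y _ hy =>
    rw [map_smulₛₗ, map_smul, map_smul, hy, smul_eq_mul, smul_eq_mul, map_mul,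
      RingEquiv.coe_toRingHom, mul_left_comm]
  | mem m hm =>
    obtain rfl | hm0 := eq_or_ne m 0
    · simp
    obtain ⟨lm, hlm⟩ := hL.exists_apply_map_eq hB hm
    rw [hlm]
    obtain rfl : lm = l := (hB.apply_ne_zero_or hn hnp hm hm0).elim
      (fun h => eq_of_apply_ne h hl hlm) (fun h => eq_of_apply_ne h hlp hlm)
    rfl

end Semilinear

theorem exists_semilinear [NeZero (2 : K)] (hB : HasWittIndexOne B) (hV : 2 < Module.rank K V)
    {g : V → V} (hg : IsNullAutomorphism B g) :
    ∃ (σ : K ≃+* K) (L : V →ₛₗ[(σ : K →+* K)] V) (l : K), l ≠ 0 ∧ (∀ x, g x = L x + g 0) ∧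
      ∀ x y, B (L x) (L y) = l * σ (B x y) := by
  have hg' := hg.recenter 0
  set g' : V →+ V :=
    AddMonoidHom.mk' (fun x => g (0 + x) - g 0) fun x y => hg'.map_add hB hV (by simp) x y
  replace hg' : IsNullAutomorphism B g' := hg'
  obtain ⟨f, hf⟩ := hg'.exists_map_smul_eq hB hV
  set σ := RingEquiv.ofBijective f ⟨f.injective, hg'.surjective_of_map_smul_eq hB hf⟩
  set L : V →ₛₗ[(σ : K →+* K)] V := { g' with map_smul' := hf }
  obtain ⟨l, hl0, hl⟩ := exists_ne_zero_apply_map_eq (L := L) hB hV hg'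
  exact ⟨σ, L, l, hl0, fun x => by simp [L, g'], hl⟩

end IsNullAutomorphism

end WittIndexOne

namespace SpacetimeModel

section LorentzForm

variable {d : ℕ} [NeZero d] {Q : Type*} [Field Q]

/-- The symmetric bilinear form whose quadratic form is the `1`-Minkowski form. -/
def lorentzForm (d : ℕ) [NeZero d] (Q : Type*) [Field Q] : LinearMap.BilinForm Q (Fin d → Q) :=
  LinearMap.mk₂ Q (fun x y => x 0 * y 0 - ∑ i ∈ Finset.univ.erase (0 : Fin d), x i * y i)
    (fun x y z => by simp only [Pi.add_apply, add_mul, Finset.sum_add_distrib]; ring)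
    (fun c x y => by
      simp only [Pi.smul_apply, smul_eq_mul, mul_sub, Finset.mul_sum, mul_assoc])
    (fun x y z => by simp only [Pi.add_apply, mul_add, Finset.sum_add_distrib]; ring)
    (fun c x y => by
      simp only [Pi.smul_apply, smul_eq_mul, mul_sub, Finset.mul_sum, mul_left_comm])

theorem lorentzForm_apply (x y : Fin d → Q) :
    lorentzForm d Q x y = x 0 * y 0 - ∑ i ∈ Finset.univ.erase (0 : Fin d), x i * y i := rfl

theorem minkowski_one (x : Fin d → Q) : minkowski 1 x = lorentzForm d Q x x := by
  simp only [lorentzForm_apply, minkowski, one_mul, pow_two]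

theorem isSymm_lorentzForm : (lorentzForm d Q).IsSymm where
  eq x y := by simp only [lorentzForm_apply, mul_comm]

theorem lorentzForm_autInduced (α : Q ≃+* Q) (x y : Fin d → Q) :
    lorentzForm d Q (autInduced α x) (autInduced α y) = α (lorentzForm d Q x y) := by
  simp only [lorentzForm_apply, autInduced, map_sub, map_mul, map_sum]

theorem lorentzForm_single_zero_right (x : Fin d → Q) :
    lorentzForm d Q x (Pi.single 0 1) = x 0 := by
  rw [lorentzForm_apply, Finset.sum_eq_zero] <;> simp +contextual

theorem lorentzForm_single_right {i : Fin d} (hi : i ≠ 0) (x : Fin d → Q) :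
    lorentzForm d Q x (Pi.single i 1) = -x i := by
  rw [lorentzForm_apply, Finset.sum_eq_single_of_mem i (by simp [hi])] <;>
    simp +contextual [hi.symm]

variable [LinearOrder Q] [IsStrictOrderedRing Q]

theorem eq_zero_of_lorentzForm_self {x : Fin d → Q} (hx : lorentzForm d Q x x = 0)
    (h0 : x 0 = 0) : x = 0 := by
  rw [lorentzForm_apply, h0, mul_zero, zero_sub, neg_eq_zero,
    Finset.sum_eq_zero_iff_of_nonneg fun i _ => mul_self_nonneg (x i)] at hx
  funext i
  obtain rfl | hi := eq_or_ne i 0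
  · exact h0
  · exact mul_self_eq_zero.1 (hx i (by simp [hi]))

theorem hasWittIndexOne_lorentzForm (hd : 2 ≤ d) : HasWittIndexOne (lorentzForm d Q) where
  isSymm := isSymm_lorentzForm
  separatingLeft x hx := eq_zero_of_lorentzForm_self (hx x) <| by
    rw [← lorentzForm_single_zero_right x, hx]
  exists_null := by
    have hi : (⟨1, hd⟩ : Fin d) ≠ 0 := by simp [Fin.ext_iff]
    refine ⟨Pi.single 0 1 + Pi.single ⟨1, hd⟩ 1, fun h => ?_, ?_⟩
    · simpa [hi] using congrFun h ⟨1, hd⟩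
    · rw [map_add, lorentzForm_single_zero_right, lorentzForm_single_right hi]
      simp [hi, hi.symm]
  exists_eq_smul u v hu0 hu hv huv := by
    have h0 : u 0 ≠ 0 := fun h => hu0 (eq_zero_of_lorentzForm_self hu h)
    refine ⟨v 0 / u 0, sub_eq_zero.1 (eq_zero_of_lorentzForm_self ?_ ?_)⟩
    · rw [bilinForm_sub_self isSymm_lorentzForm, bilinForm_smul_self, map_smul,
        isSymm_lorentzForm.eq v u, hu, hv, huv]
      simp
    · simp [h0]

theorem exists_isAlmostLorentz_comp (hd : 3 ≤ d) {g : (Fin d → Q) → (Fin d → Q)}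
    (hg : IsNullAutomorphism (lorentzForm d Q) g) :
    ∃ (A : (Fin d → Q) ≃ₗ[Q] (Fin d → Q)) (α : Q ≃+* Q) (b : Fin d → Q),
      IsAlmostLorentz A ∧ g = translation b ∘ autInduced α ∘ A := by
  have hB : HasWittIndexOne (lorentzForm d Q) := hasWittIndexOne_lorentzForm (by omega)
  have hV : 2 < Module.rank Q (Fin d → Q) := by rw [rank_fin_fun]; exact_mod_cast hd
  obtain ⟨α, L, l, hl, hgL, hL⟩ := hg.exists_semilinear hB hV
  let A₀ : (Fin d → Q) →ₗ[Q] (Fin d → Q) :=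
    { toFun := fun x => autInduced α.symm (L x)
      map_add' := fun x y => by ext i; simp [autInduced]
      map_smul' := fun t x => by ext i; simp [autInduced] }
  have hA₀ : ∀ x, autInduced α (A₀ x) = g x - g 0 := fun x => by
    ext i; simp [A₀, autInduced, hgL x]
  have hA₀_inj : Function.Injective A₀ := fun x y hxy => hg.injective hB <| by
    simpa [hA₀] using congrArg (autInduced α) hxy
  let A := LinearEquiv.ofInjectiveEndo A₀ hA₀_inj
  refine ⟨A, α, g 0, ⟨α.symm l, by simpa using hl, fun x => ?_⟩, funext fun x => ?_⟩
  · rw [minkowski_one, minkowski_one]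
    change lorentzForm d Q (autInduced α.symm (L x)) (autInduced α.symm (L x)) = _
    rw [lorentzForm_autInduced, hL, map_mul, α.symm_apply_apply]
  · change g x = autInduced α (A₀ x) + g 0
    rw [hA₀, sub_add_cancel]

end LorentzForm

section Rescaling

variable {d : ℕ} [NeZero d] {Q : Type*} [Field Q] {c : Q}

/-- The rescaling of the spatial coordinates as a permutation. -/
def spaceRescaleEquiv (hc : c ≠ 0) : (Fin d → Q) ≃ (Fin d → Q) where
  toFun := spaceRescale c
  invFun := spaceRescale c⁻¹
  left_inv x := by ext i; by_cases hi : i = 0 <;> simp [spaceRescale, hi, hc]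
  right_inv x := by ext i; by_cases hi : i = 0 <;> simp [spaceRescale, hi, hc]

/-- The rescaling of the time coordinate as a permutation. -/
def timeRescaleEquiv (hc : c ≠ 0) : (Fin d → Q) ≃ (Fin d → Q) where
  toFun := timeRescale c
  invFun := timeRescale c⁻¹
  left_inv x := by ext i; by_cases hi : i = 0 <;> simp [timeRescale, hi, hc]
  right_inv x := by ext i; by_cases hi : i = 0 <;> simp [timeRescale, hi, hc]

theorem timeRescale_spaceRescale (x : Fin d → Q) :
    timeRescale c (spaceRescale c x) = c • x := by
  ext i; by_cases hi : i = 0 <;> simp [timeRescale, spaceRescale, hi]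

/-- Being the ends of a segment of speed `c`, which for light speed `c` is what `AxPh` turns
connectibility by a light signal into. -/
def LightlikeSeparated (c : Q) (x y : Fin d → Q) : Prop :=
  space2 x y = c ^ 2 * time x y ^ 2

theorem null_timeRescale_sub_iff (x y : Fin d → Q) :
    lorentzForm d Q (timeRescale c x - timeRescale c y) (timeRescale c x - timeRescale c y) = 0 ↔
      LightlikeSeparated c x y := by
  have hspace : ∑ i ∈ Finset.univ.erase (0 : Fin d), (timeRescale c x - timeRescale c y) i *
      (timeRescale c x - timeRescale c y) i = space2 x y :=
    Finset.sum_congr rfl fun i hi => by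
      simp [timeRescale, (Finset.mem_erase.1 hi).1, pow_two]
  have htime : (timeRescale c x - timeRescale c y) 0 = c * time x y := by
    simp [timeRescale, time, mul_sub]
  rw [lorentzForm_apply, hspace, htime, ← pow_two, mul_pow, sub_eq_zero, eq_comm,
    LightlikeSeparated]

theorem lightlikeSeparated_spaceRescale_iff (hc : c ≠ 0) (x y : Fin d → Q) :
    LightlikeSeparated c (spaceRescale c x) (spaceRescale c y) ↔
      lorentzForm d Q (x - y) (x - y) = 0 := by
  rw [← null_timeRescale_sub_iff, timeRescale_spaceRescale, timeRescale_spaceRescale, ← smul_sub,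
    bilinForm_smul_self]
  simp [hc]

variable {c' : Q} {F : (Fin d → Q) → (Fin d → Q)}

theorem isNullAutomorphism_spaceRescale_comp (hc : c ≠ 0) (hc' : c' ≠ 0)
    (hF : F.Surjective)
    (h : ∀ x y, LightlikeSeparated c' (F x) (F y) ↔ LightlikeSeparated c x y) :
    IsNullAutomorphism (lorentzForm d Q)
      ((spaceRescaleEquiv hc').symm ∘ F ∘ spaceRescaleEquiv hc) where
  surjective := (Equiv.surjective _).comp (hF.comp (Equiv.surjective _))
  null_sub_iff x y := by
    have hsymm : ∀ z : Fin d → Q, spaceRescale c' ((spaceRescaleEquiv hc').symm z) = z :=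
      (spaceRescaleEquiv hc').apply_symm_apply
    rw [← lightlikeSeparated_spaceRescale_iff hc', ← lightlikeSeparated_spaceRescale_iff hc, ← h]
    simp only [Function.comp_apply, hsymm]
    rfl

theorem isNullAutomorphism_timeRescale_comp (hc : c ≠ 0) (hc' : c' ≠ 0)
    (hF : F.Surjective)
    (h : ∀ x y, LightlikeSeparated c' (F x) (F y) ↔ LightlikeSeparated c x y) :
    IsNullAutomorphism (lorentzForm d Q)
      (timeRescaleEquiv hc' ∘ F ∘ (timeRescaleEquiv hc).symm) where
  surjective := (Equiv.surjective _).comp (hF.comp (Equiv.surjective _))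
  null_sub_iff x y := by
    obtain ⟨x, rfl⟩ := (timeRescaleEquiv hc).surjective x
    obtain ⟨y, rfl⟩ := (timeRescaleEquiv hc).surjective y
    simp only [Function.comp_apply, Equiv.symm_apply_apply]
    exact (null_timeRescale_sub_iff _ _).trans ((h x y).trans (null_timeRescale_sub_iff x y).symm)

end Rescaling

section Decomposition

variable {d : ℕ} [NeZero d] {Q : Type*} [Field Q] [LinearOrder Q] [IsStrictOrderedRing Q]
  {c c' : Q} {F : (Fin d → Q) → (Fin d → Q)}

theorem exists_graph_eq_comp_spaceRescale (hd : 3 ≤ d) (hc : c ≠ 0) (hc' : c' ≠ 0)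
    (hF : F.Surjective)
    (h : ∀ x y, LightlikeSeparated c' (F x) (F y) ↔ LightlikeSeparated c x y) :
    ∃ (A : (Fin d → Q) ≃ₗ[Q] (Fin d → Q)) (α : Q ≃+* Q) (b : Fin d → Q), IsAlmostLorentz A ∧
      F.graph = (Function.graph (spaceRescale c)).inv ○ Function.graph A ○
        Function.graph (autInduced α) ○ Function.graph (translation b) ○
        Function.graph (spaceRescale c') := by
  obtain ⟨A, α, b, hA, hg⟩ :=
    exists_isAlmostLorentz_comp hd (isNullAutomorphism_spaceRescale_comp hc hc' hF h)
  have hF_eq : F = spaceRescaleEquiv hc' ∘ (translation b ∘ autInduced α ∘ A) ∘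
      (spaceRescaleEquiv hc).symm := by
    rw [← hg]; ext; simp
  refine ⟨A, α, b, hA, ?_⟩
  rw [hF_eq]
  simp only [Function.graph_comp, Equiv.graph_inv, SetRel.comp_assoc]
  rfl

theorem exists_graph_eq_comp_timeRescale (hd : 3 ≤ d) (hc : c ≠ 0) (hc' : c' ≠ 0)
    (hF : F.Surjective)
    (h : ∀ x y, LightlikeSeparated c' (F x) (F y) ↔ LightlikeSeparated c x y) :
    ∃ (A : (Fin d → Q) ≃ₗ[Q] (Fin d → Q)) (α : Q ≃+* Q) (b : Fin d → Q), IsAlmostLorentz A ∧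
      F.graph = Function.graph (timeRescale c) ○ Function.graph A ○
        Function.graph (autInduced α) ○ Function.graph (translation b) ○
        (Function.graph (timeRescale c')).inv := by
  obtain ⟨A, α, b, hA, hg⟩ :=
    exists_isAlmostLorentz_comp hd (isNullAutomorphism_timeRescale_comp hc hc' hF h)
  have hF_eq : F = (timeRescaleEquiv hc').symm ∘ (translation b ∘ autInduced α ∘ A) ∘
      timeRescaleEquiv hc := by
    rw [← hg]; ext; simp
  refine ⟨A, α, b, hA, ?_⟩
  rw [hF_eq]
  simp only [Function.graph_comp, Equiv.graph_inv, SetRel.comp_assoc]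
  rfl

end Decomposition

section Worldview

variable {d : ℕ} [NeZero d] {Q : Type*} [Field Q] [LinearOrder Q] {B : Type*}
  {M : SpacetimeModel d B Q} {m k : B}

theorem ev_nonempty (hPh : M.AxPh) (hm : m ∈ M.IOb) (x : Fin d → Q) : (M.ev m x).Nonempty := by
  obtain ⟨c, -, h⟩ := hPh m hm
  obtain ⟨p, -, hp, -⟩ := (h x x).2 (by simp [space2, time])
  exact ⟨p, hp⟩

variable [IsStrictOrderedRing Q]

theorem IsLightSpeed.exists_photon_iff (hd : 2 ≤ d) (hPh : M.AxPh) (hm : m ∈ M.IOb) {c : Q}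
    (hc : M.IsLightSpeed m c) (x y : Fin d → Q) :
    (∃ p ∈ M.Ph, M.W m p x ∧ M.W m p y) ↔ LightlikeSeparated c x y := by
  obtain ⟨v, hv, h⟩ := hPh m hm
  obtain rfl : v = c :=
    (M.existsUnique_isLightSpeed hd hPh hm).unique ⟨hv, fun x y => (h x y).1⟩ hc
  exact h x y

theorem ev_injective (hd : 2 ≤ d) (hPh : M.AxPh) (hm : m ∈ M.IOb) :
    Function.Injective (M.ev m) := by
  intro x y hxy
  obtain ⟨c, hc, h⟩ := hPh m hm
  have hlight : ∀ z, LightlikeSeparated c z x ↔ LightlikeSeparated c z y := fun z => by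
    have hW : ∀ p, M.W m p x ↔ M.W m p y := Set.ext_iff.1 hxy
    simp only [LightlikeSeparated, ← h, hW]
  refine (timeRescaleEquiv hc.ne').injective <|
    (hasWittIndexOne_lorentzForm hd).eq_of_forall_null_sub_iff ?_
  rw [(timeRescaleEquiv hc.ne').surjective.forall]
  exact fun z => (null_timeRescale_sub_iff z x).trans <|
    (hlight z).trans (null_timeRescale_sub_iff z y).symm

theorem exists_surjective_worldview_eq_graph (hd : 2 ≤ d) (hEv : M.AxEv) (hPh : M.AxPh)
    (hm : m ∈ M.IOb) (hk : k ∈ M.IOb) :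
    ∃ F : (Fin d → Q) → (Fin d → Q), F.Surjective ∧ M.worldview m k = F.graph ∧
      ∀ x, M.ev m x = M.ev k (F x) := by
  choose F hF using hEv m hm k hk
  refine ⟨F, fun y => ?_, ?_, hF⟩
  · obtain ⟨x, hx⟩ := hEv k hk m hm y
    exact ⟨x, ev_injective hd hPh hk ((hF x).symm.trans hx.symm)⟩
  · ext ⟨x, y⟩
    change M.ev m x = M.ev k y ∧ (M.ev m x).Nonempty ↔ F x = y
    rw [and_iff_left (ev_nonempty hPh hm x), hF, (ev_injective hd hPh hk).eq_iff]

theorem exists_worldview_eq_graph (hd : 2 ≤ d) (hEv : M.AxEv) (hPh : M.AxPh)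
    (hm : m ∈ M.IOb) (hk : k ∈ M.IOb) {cm ck : Q} (hcm : M.IsLightSpeed m cm)
    (hck : M.IsLightSpeed k ck) :
    ∃ F : (Fin d → Q) → (Fin d → Q), F.Surjective ∧ M.worldview m k = F.graph ∧
      ∀ x y, LightlikeSeparated ck (F x) (F y) ↔ LightlikeSeparated cm x y := by
  obtain ⟨F, hsurj, hF, hev⟩ := exists_surjective_worldview_eq_graph hd hEv hPh hm hk
  refine ⟨F, hsurj, hF, fun x y => ?_⟩
  have hW : ∀ p x, M.W m p x ↔ M.W k p (F x) := fun p x => Set.ext_iff.1 (hev x) p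
  simp only [← hcm.exists_photon_iff hd hPh hm, ← hck.exists_photon_iff hd hPh hk, hW]

end Worldview

end SpacetimeModel

theorem theorem7p8 {d : ℕ} [NeZero d] (hd : 3 ≤ d) {B Q : Type*}
    [Field Q] [LinearOrder Q] [IsStrictOrderedRing Q]
    (M : SpacetimeModel d B Q) (hEv : M.AxEv) (hPh : M.AxPh)
    (m k : B) (hm : m ∈ M.IOb) (hk : k ∈ M.IOb)
    (cm ck : Q) (hcm : M.IsLightSpeed m cm) (hck : M.IsLightSpeed k ck) :
    (∃ (A : (Fin d → Q) ≃ₗ[Q] (Fin d → Q)) (α : Q ≃+* Q) (b : Fin d → Q),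
      SpacetimeModel.IsAlmostLorentz A ∧
      M.worldview m k =
        (Function.graph (SpacetimeModel.spaceRescale cm)).inv ○ Function.graph A ○
          Function.graph (SpacetimeModel.autInduced α) ○
          Function.graph (SpacetimeModel.translation b) ○
          Function.graph (SpacetimeModel.spaceRescale ck)) ∧
    (∃ (A : (Fin d → Q) ≃ₗ[Q] (Fin d → Q)) (α : Q ≃+* Q) (b : Fin d → Q),
      SpacetimeModel.IsAlmostLorentz A ∧
      M.worldview m k =
        Function.graph (SpacetimeModel.timeRescale cm) ○ Function.graph A ○
          Function.graph (SpacetimeModel.autInduced α) ○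
          Function.graph (SpacetimeModel.translation b) ○
          (Function.graph (SpacetimeModel.timeRescale ck)).inv) := by
  obtain ⟨F, hsurj, hF, hlight⟩ :=
    SpacetimeModel.exists_worldview_eq_graph (by omega) hEv hPh hm hk hcm hck
  rw [hF]
  exact ⟨SpacetimeModel.exists_graph_eq_comp_spaceRescale hd hcm.1.ne' hck.1.ne' hsurj hlight,
    SpacetimeModel.exists_graph_eq_comp_timeRescale hd hcm.1.ne' hck.1.ne' hsurj hlight⟩
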